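/- Let $G$ be a finite group with a BN-pair $(B,N)$ of rank $n+1$ ($n\ge 0$), that is: $B,N$ are subgroups generating $G$, $B\cap N$ is normal in $N$, and the Weyl group $W=N/(B\cap N)$ is generated by a set $\mathfrak S$ of $n+1$ elements of order $2$ such that $sBw\subseteq BswB\cup BwB$ and $sBs^{-1}\not\subseteq B$ for all $s\in\mathfrak S$, $w\in W$. For $J\subseteq\mathfrak S$ let $G_J=B\langle J\rangle B$ be the standard parabolic subgroup, and for $s\in\mathfrak S$ let $(s)=\mathfrak S\setminus\{s\}$. Let $\Delta=\Delta(G;B,N)$ be the associated spherical building: the $n$-dimensional simplicial complex on the vertex set $V=\bigsqcup_{s\in\mathfrak S}G/G_{(s)}$ whose maximal faces are the chambers $C_g=\{gG_{(s)}:s\in\mathfrak S\}$, $g\in G$. For $g\in G$ let the apartment $A_g$ be the subcomplex of $\Delta$ induced on the vertex set $V_g=\{gwG_{(s)}:w\in W,\ s\in\mathfrak S\}$. Let $k\ge 1$, let $g_1,\dots,g_k\in G$ and let $Y=\bigcap_{i=1}^k A_{g_i}$. If $\dim Y=n$, then the reduced simplicial homology with $\mathbb F_2$ coefficients satisfies $\tilde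 H_i(Y;\mathbb F_2)=0$ for all integers $i\le n-1$. -/

import Mathlib

universe u

/-- A BN-pair (Tits system) in a group `G`: subgroups `B`, `N` generating `G` such that `B ∩ N` is
normal in `N`, together with the distinguished set `S` of generators of the Weyl group
`W = N / (B ∩ N)`. The subgroup `B.subgroupOf N` is `B ∩ N` regarded as a subgroup of `N`. -/
structure BNPair (G : Type u) [Group G] where
  B : Subgroup G
  N : Subgroup G
  sup_eq_top : B ⊔ N = ⊤
  normal : (B.subgroupOf N).Normal
  S : Set (N ⧸ B.subgroupOf N)
  closure_S : Subgroup.closure S = ⊤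
  orderOf_S : ∀ s ∈ S, orderOf s = 2
  /-- `s B w ⊆ B s w B ∪ B w B` for `s ∈ S` and `w ∈ W`. -/
  mul_mem : ∀ s w : N, (s : N ⧸ B.subgroupOf N) ∈ S → ∀ b ∈ B,
    (s : G) * b * (w : G) ∈
      DoubleCoset.doubleCoset ((s : G) * (w : G)) (B : Set G) (B : Set G) ∪
        DoubleCoset.doubleCoset (w : G) (B : Set G) (B : Set G)
  /-- `s B s⁻¹ ⊄ B` for `s ∈ S`. -/
  not_le : ∀ s : N, (s : N ⧸ B.subgroupOf N) ∈ S → ∃ b ∈ B, (s : G) * b * (s : G)⁻¹ ∉ B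

namespace BNPair

variable {G : Type u} [Group G] (P : BNPair G)

/-- The Weyl group `W = N / (B ∩ N)`. -/
abbrev Weyl : Type u := P.N ⧸ P.B.subgroupOf P.N

instance : (P.B.subgroupOf P.N).Normal := P.normal

/-- The rank of a BN-pair: the number of distinguished generators. -/
noncomputable def rank : ℕ := Nat.card P.S

/-- The subgroup `W_J = ⟨J⟩` of the Weyl group, for `J ⊆ S`. -/
def weylParabolic (J : Set P.S) : Subgroup P.Weyl :=
  Subgroup.closure (Subtype.val '' J)

/-- The set `B W_J B`, for `J ⊆ S`. -/
def parabolicSet (J : Set P.S) : Set G :=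
  {x | ∃ w : P.N, (w : P.Weyl) ∈ P.weylParabolic J ∧
    x ∈ DoubleCoset.doubleCoset (w : G) (P.B : Set G) (P.B : Set G)}

theorem mul_mem_parabolicSet_of_B (J : Set P.S) {b x : G} (hb : b ∈ P.B)
    (hx : x ∈ P.parabolicSet J) : b * x ∈ P.parabolicSet J := by
  obtain ⟨w, hw, h⟩ := hx
  obtain ⟨c, hc, d, hd, rfl⟩ := DoubleCoset.mem_doubleCoset.1 h
  exact ⟨w, hw, DoubleCoset.mem_doubleCoset.2
    ⟨b * c, P.B.mul_mem hb hc, d, hd, by simp only [mul_assoc]⟩⟩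

theorem mul_mem_parabolicSet_of_gen (J : Set P.S) {s : P.N}
    (hs : (s : P.Weyl) ∈ Subtype.val '' J) {x : G} (hx : x ∈ P.parabolicSet J) :
    (s : G) * x ∈ P.parabolicSet J := by
  obtain ⟨w, hw, h⟩ := hx
  obtain ⟨c, hc, d, hd, rfl⟩ := DoubleCoset.mem_doubleCoset.1 h
  have hsS : (s : P.Weyl) ∈ P.S := by
    obtain ⟨t, -, ht⟩ := hs
    rw [← ht]; exact t.2
  rcases P.mul_mem s w hsS c hc with h' | h'
  · obtain ⟨e, he, f, hf, hef⟩ := DoubleCoset.mem_doubleCoset.1 h'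
    refine ⟨s * w, ?_, DoubleCoset.mem_doubleCoset.2
      ⟨e, he, f * d, P.B.mul_mem hf hd, ?_⟩⟩
    · exact (P.weylParabolic J).mul_mem (Subgroup.subset_closure hs) hw
    · calc (s : G) * (c * w * d) = (s * c * w) * d := by simp only [mul_assoc]
        _ = _ := by rw [hef]; simp only [mul_assoc, Subgroup.coe_mul]
  · obtain ⟨e, he, f, hf, hef⟩ := DoubleCoset.mem_doubleCoset.1 h'
    refine ⟨w, hw, DoubleCoset.mem_doubleCoset.2 ⟨e, he, f * d, P.B.mul_mem hf hd, ?_⟩⟩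
    calc (s : G) * (c * w * d) = (s * c * w) * d := by simp only [mul_assoc]
      _ = _ := by rw [hef]; simp only [mul_assoc]

theorem mul_mem_parabolicSet_of_weyl (J : Set P.S) (w : P.Weyl) (hw : w ∈ P.weylParabolic J) :
    ∀ v : P.N, (v : P.Weyl) = w → ∀ x ∈ P.parabolicSet J, (v : G) * x ∈ P.parabolicSet J := by
  induction hw using Subgroup.closure_induction_left with
  | one =>
    intro v hv x hx
    exact P.mul_mem_parabolicSet_of_B J
      (Subgroup.mem_subgroupOf.1 ((QuotientGroup.eq_one_iff v).1 hv)) hx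
  | mul_left s hs y hy ih =>
    intro v hv x hx
    obtain ⟨t, rfl⟩ := QuotientGroup.mk_surjective s
    have h := ih (t⁻¹ * v) (by rw [QuotientGroup.mk_mul, hv, QuotientGroup.mk_inv]; group) x hx
    have h2 := P.mul_mem_parabolicSet_of_gen J hs h
    simpa [mul_assoc] using h2
  | inv_mul_cancel s hs y hy ih =>
    intro v hv x hx
    have hsS : s ∈ P.S := by
      obtain ⟨t, -, ht⟩ := hs
      rw [← ht]; exact t.2
    have hsq : s⁻¹ = s := by
      have := pow_orderOf_eq_one s
      rw [P.orderOf_S s hsS, pow_two] at this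
      exact inv_eq_of_mul_eq_one_left this
    obtain ⟨t, rfl⟩ := QuotientGroup.mk_surjective s
    rw [hsq] at hv
    have h := ih (t⁻¹ * v) (by rw [QuotientGroup.mk_mul, hv, QuotientGroup.mk_inv]; group) x hx
    have h2 := P.mul_mem_parabolicSet_of_gen J hs h
    simpa [mul_assoc] using h2

/-- The standard parabolic subgroup `G_J = B W_J B`, for `J ⊆ S`. -/
def parabolic (J : Set P.S) : Subgroup G where
  carrier := P.parabolicSet J
  one_mem' := ⟨1, (P.weylParabolic J).one_mem, DoubleCoset.mem_doubleCoset.2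
    ⟨1, P.B.one_mem, 1, P.B.one_mem, by simp⟩⟩
  mul_mem' := by
    rintro x y ⟨w, hw, h⟩ hy
    obtain ⟨c, hc, d, hd, rfl⟩ := DoubleCoset.mem_doubleCoset.1 h
    have := P.mul_mem_parabolicSet_of_B J hc
      (P.mul_mem_parabolicSet_of_weyl J w hw w rfl _ (P.mul_mem_parabolicSet_of_B J hd hy))
    simpa only [mul_assoc] using this
  inv_mem' := by
    rintro x ⟨w, hw, h⟩
    obtain ⟨c, hc, d, hd, rfl⟩ := DoubleCoset.mem_doubleCoset.1 h
    exact ⟨w⁻¹, (P.weylParabolic J).inv_mem hw, DoubleCoset.mem_doubleCoset.2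
      ⟨d⁻¹, P.B.inv_mem hd, c⁻¹, P.B.inv_mem hc, by simp [mul_assoc]⟩⟩

/-- The vertex set of the building: the disjoint union over `s ∈ S` of the coset spaces
`G / G_(s)`, where `(s) = S \ {s}`. -/
abbrev Vertex : Type u := Σ s : P.S, G ⧸ P.parabolic {s}ᶜ

/-- The vertex `g G_(s)`. -/
def vertex (g : G) (s : P.S) : P.Vertex := ⟨s, (g : G ⧸ P.parabolic {s}ᶜ)⟩

/-- The vertices of the chamber `C_g = {g G_(s) : s ∈ S}`. -/
def chamber (g : G) : Set P.Vertex := Set.range (P.vertex g)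

/-- The building `Δ(G; B, N)`: the simplices are the nonempty finite subsets of chambers. -/
def building : PreAbstractSimplicialComplex P.Vertex where
  faces := {σ | σ.Nonempty ∧ ∃ g : G, (σ : Set P.Vertex) ⊆ P.chamber g}
  isRelLowerSet_faces := by
    rintro σ ⟨hσ, g, hg⟩
    exact ⟨hσ, fun τ hτ hne => ⟨hne, g, (Finset.coe_subset.2 hτ).trans hg⟩⟩

end BNPair

namespace PreAbstractSimplicialComplex

variable {V : Type u}

/-- The induced subcomplex `K[U]` on a set `U` of vertices. -/
def induced (K : PreAbstractSimplicialComplex V) (U : Set V) : PreAbstractSimplicialComplex V where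
  faces := {σ | σ ∈ K.faces ∧ (σ : Set V) ⊆ U}
  isRelLowerSet_faces := by
    rintro σ ⟨hσ, hU⟩
    exact ⟨(K.isRelLowerSet_faces hσ).1, fun τ hτ hne =>
      ⟨(K.isRelLowerSet_faces hσ).2 hτ hne, (Finset.coe_subset.2 hτ).trans hU⟩⟩

/-- `K` has dimension `d`: the maximum of `|σ| - 1` over the simplices `σ` of `K` is `d`. -/
def HasDim (K : PreAbstractSimplicialComplex V) (d : ℤ) : Prop :=
  IsGreatest ((fun σ : Finset V => (σ.card : ℤ) - 1) '' K.faces) d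

/-- The `i`-dimensional simplices of `K`, where the empty set is the only simplex of
dimension `-1`. -/
abbrev Simplex (K : PreAbstractSimplicialComplex V) (i : ℤ) : Type u :=
  {σ : Finset V // (σ = ∅ ∨ σ ∈ K.faces) ∧ (σ.card : ℤ) = i + 1}

/-- The augmented simplicial `i`-chains of `K` with coefficients in `𝔽₂`. -/
abbrev Chain (K : PreAbstractSimplicialComplex V) (i : ℤ) : Type u :=
  K.Simplex i →₀ ZMod 2

open Classical in
/-- The facet of a simplex `σ` opposite to a vertex `v` of `σ`. -/
noncomputable def facet (K : PreAbstractSimplicialComplex V) {i j : ℤ} (h : j + 1 = i)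
    (σ : K.Simplex i) (v : σ.1) : K.Simplex j :=
  ⟨σ.1.erase v, by
    constructor
    · rcases σ.2.1 with h0 | h0
      · exact Or.inl (by simp [h0])
      · rcases (σ.1.erase (v : V)).eq_empty_or_nonempty with he | he
        · exact Or.inl he
        · exact Or.inr ((K.isRelLowerSet_faces h0).2 (Finset.erase_subset _ _) he)
    · have h1 := Finset.card_erase_add_one v.2
      have h2 := σ.2.2
      omega⟩

/-- The boundary map `∂ : C_i → C_j` for `i = j + 1`, sending a simplex to the sum of its facets. -/
noncomputable def boundary (K : PreAbstractSimplicialComplex V) (i j : ℤ) (h : j + 1 = i) :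
    K.Chain i →ₗ[ZMod 2] K.Chain j :=
  Finsupp.linearCombination (ZMod 2) fun σ : K.Simplex i =>
    ∑ v : σ.1, Finsupp.single (K.facet h σ v) (1 : ZMod 2)

theorem boundary_boundary (K : PreAbstractSimplicialComplex V) (i j l : ℤ) (h : j + 1 = i)
    (h' : l + 1 = j) (c : K.Chain i) : K.boundary j l h' (K.boundary i j h c) = 0 := by
  classical
  suffices H : (K.boundary j l h').comp (K.boundary i j h) = 0 from LinearMap.congr_fun H c
  refine Finsupp.lhom_ext' fun σ => LinearMap.ext_ring ?_
  simp only [boundary, LinearMap.comp_apply, Finsupp.lsingle_apply,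
    Finsupp.linearCombination_single, one_smul, map_sum, LinearMap.zero_apply]
  rw [Finset.sum_sigma']
  refine Finset.sum_involution
    (fun x _ => ⟨⟨x.2.1, Finset.mem_of_mem_erase x.2.2⟩, ⟨x.1.1, Finset.mem_erase.2
      ⟨fun e => (Finset.mem_erase.1 x.2.2).1 e.symm, x.1.2⟩⟩⟩) ?_ ?_ ?_ ?_
  · rintro ⟨v, w⟩ -
    have e : K.facet h' (K.facet h σ v) w = K.facet h' (K.facet h σ
        ⟨w.1, Finset.mem_of_mem_erase w.2⟩) ⟨v.1, Finset.mem_erase.2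
          ⟨fun e => (Finset.mem_erase.1 w.2).1 e.symm, v.2⟩⟩ := by
      apply Subtype.ext
      simp only [facet]
      exact Finset.erase_right_comm
    rw [← e, ← Finsupp.single_add]
    simp [show (1 : ZMod 2) + 1 = 0 from rfl]
  · rintro ⟨v, w⟩ - - e
    have h1 : w.1 = v.1 := congrArg (fun x => x.1.1) e
    exact (Finset.mem_erase.1 w.2).1 h1
  · intros; exact Finset.mem_univ _
  · rintro ⟨v, w⟩ -
    rfl

/-- The space of (reduced) `i`-cycles. -/
noncomputable def cycles (K : PreAbstractSimplicialComplex V) (i : ℤ) :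
    Submodule (ZMod 2) (K.Chain i) :=
  LinearMap.ker (K.boundary i (i - 1) (by ring))

/-- The space of `i`-boundaries. -/
noncomputable def boundaries (K : PreAbstractSimplicialComplex V) (i : ℤ) :
    Submodule (ZMod 2) (K.Chain i) :=
  LinearMap.range (K.boundary (i + 1) i rfl)

theorem boundaries_le_cycles (K : PreAbstractSimplicialComplex V) (i : ℤ) :
    K.boundaries i ≤ K.cycles i := by
  rintro _ ⟨c, rfl⟩
  exact K.boundary_boundary _ _ _ _ _ c

/-- The `i`-boundaries as a subspace of the `i`-cycles. -/
noncomputable def boundariesInCycles (K : PreAbstractSimplicialComplex V) (i : ℤ) :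
    Submodule (ZMod 2) (K.cycles i) :=
  (K.boundaries i).comap (K.cycles i).subtype

/-- The reduced simplicial homology `H̃_i(K; 𝔽₂)`: cycles modulo boundaries. -/
abbrev ReducedHomology (K : PreAbstractSimplicialComplex V) (i : ℤ) : Type u :=
  K.cycles i ⧸ K.boundariesInCycles i

end PreAbstractSimplicialComplex

namespace BNPair

variable {G : Type u} [Group G] (P : BNPair G)

/-- The vertex set `V_g = {g w G_(s) : w ∈ W, s ∈ S}`. Since `B ∩ N ⊆ G_(s)`, the coset `w G_(s)`
does not depend on the representative of `w` in `N`. -/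
def apartmentVertices (g : G) : Set P.Vertex :=
  {v | ∃ (w : P.N) (s : P.S), v = P.vertex (g * (w : G)) s}

/-- The apartment `A_g`: the subcomplex of the building induced on `V_g`. -/
def apartment (g : G) : PreAbstractSimplicialComplex P.Vertex :=
  P.building.induced (P.apartmentVertices g)

end BNPair

/-!
A simplex of `Y` of top dimension is a chamber, so all the apartments are `A_{x c}` for one `x` and
various `c ∈ B`, one of which may be taken to be `1`. The retraction of the building onto `A_x` then
identifies the chambers of `Y` with the Weyl elements `w` whose chamber `x w` is equal to `x c w`
for each `c`.

If a face of the chamber `x w` is shared by the apartments, so is its gate: the chamber through that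
face for which the Weyl element is shortest. Two consequences follow. Every simplex of `Y` lies in a
chamber of `Y`, and if a chamber `w` of `Y` has a descent `s`, then `w s` is again a chamber of `Y`.
Hence adding the chambers of `Y` by increasing length is a shelling, where `w` is attached along the
facets opposite to its vertices of types the descents of `w`.

When a simplex is added in a shelling, the part of a cycle lying in the new simplex can be coned off
from a vertex at which it is not attached, and a cycle below the top dimension cannot
meet the interior of a simplex attached along its whole boundary. So no homology appears below the
top dimension.
-/

section WordLength

variable {M : Type*} [Monoid M] {S : Set M} {v w : M}

/-- The least length of a word in `S` with product `w`. It has the junk value `0` outside the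
submonoid generated by `S`. -/
noncomputable def wordLength (S : Set M) (w : M) : ℕ :=
  sInf {k | ∃ l : List M, (∀ x ∈ l, x ∈ S) ∧ l.prod = w ∧ l.length = k}

theorem wordLength_prod_le {l : List M} (hl : ∀ x ∈ l, x ∈ S) :
    wordLength S l.prod ≤ l.length :=
  Nat.sInf_le ⟨l, hl, rfl, rfl⟩

theorem wordLength_one : wordLength S (1 : M) = 0 :=
  Nat.le_zero.1 (wordLength_prod_le (l := []) (by simp))

theorem wordLength_le_one (hw : w ∈ S) : wordLength S w ≤ 1 := by
  simpa using wordLength_prod_le (S := S) (l := [w]) (by simpa using hw)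

theorem exists_word_length_eq_wordLength (hw : w ∈ Submonoid.closure S) :
    ∃ l : List M, (∀ x ∈ l, x ∈ S) ∧ l.prod = w ∧ l.length = wordLength S w := by
  obtain ⟨l, hl, hlw⟩ := Submonoid.exists_list_of_mem_closure hw
  exact Nat.sInf_mem (s := {k | ∃ l : List M, (∀ x ∈ l, x ∈ S) ∧ l.prod = w ∧ l.length = k})
    ⟨l.length, l, hl, hlw, rfl⟩

theorem wordLength_mul_le (hv : v ∈ Submonoid.closure S) (hw : w ∈ Submonoid.closure S) :
    wordLength S (v * w) ≤ wordLength S v + wordLength S w := by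
  obtain ⟨l, hl, rfl, hlen⟩ := exists_word_length_eq_wordLength hv
  obtain ⟨m, hm, rfl, hmlen⟩ := exists_word_length_eq_wordLength hw
  rw [← hlen, ← hmlen, ← List.prod_append, ← List.length_append]
  exact wordLength_prod_le fun x hx => (List.mem_append.1 hx).elim (hl x) (hm x)

theorem eq_one_of_wordLength_eq_zero (hw : w ∈ Submonoid.closure S) (h : wordLength S w = 0) :
    w = 1 := by
  obtain ⟨l, -, rfl, hlen⟩ := exists_word_length_eq_wordLength hw
  rw [h, List.length_eq_zero_iff] at hlen
  rw [hlen, List.prod_nil]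

theorem exists_eq_mul_wordLength_eq_succ (hw : w ∈ Submonoid.closure S) (hne : w ≠ 1) :
    ∃ s ∈ S, ∃ v, w = s * v ∧ wordLength S w = wordLength S v + 1 := by
  obtain ⟨l, hl, rfl, hlen⟩ := exists_word_length_eq_wordLength hw
  cases l with
  | nil => exact absurd List.prod_nil hne
  | cons s l =>
    simp only [List.mem_cons, forall_eq_or_imp] at hl
    refine ⟨s, hl.1, l.prod, List.prod_cons, ?_⟩
    have hle : wordLength S (s * l.prod) ≤ wordLength S s + wordLength S l.prod :=
      wordLength_mul_le (Submonoid.subset_closure hl.1)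
        (Submonoid.list_prod_mem _ fun x hx => Submonoid.subset_closure (hl.2 x hx))
    have hs := wordLength_le_one hl.1
    have htail := wordLength_prod_le hl.2
    simp only [List.prod_cons, List.length_cons] at hlen ⊢
    omega

theorem finite_setOf_wordLength_le (hS : Submonoid.closure S = ⊤) (hfin : S.Finite) (k : ℕ) :
    {w | wordLength S w ≤ k}.Finite := by
  have := hfin.to_subtype
  refine ((List.finite_length_le S k).image fun l => (l.map Subtype.val).prod).subset ?_
  intro w hw
  obtain ⟨l, hl, rfl, hlen⟩ := exists_word_length_eq_wordLength (hS ▸ Submonoid.mem_top w)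
  lift l to List S using hl
  exact ⟨l, by simpa using hlen.trans_le hw, rfl⟩

end WordLength

/-- A set `S` of generating involutions of a group satisfying the folding condition. This is
equivalent to the exchange condition, hence to `S` being the set of simple reflections of a Coxeter
system. -/
structure IsCoxeterGenerating {W : Type*} [Group W] (S : Set W) : Prop where
  closure_eq_top : Submonoid.closure S = ⊤
  mul_self : ∀ s ∈ S, s * s = 1
  wordLength_mul_ne : ∀ s ∈ S, ∀ w, wordLength S (w * s) ≠ wordLength S w
  fold : ∀ s ∈ S, ∀ t ∈ S, ∀ w, wordLength S w < wordLength S (w * t) →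
    wordLength S (s * w * t) < wordLength S (s * w) → s * w = w * t

/-- `w` has minimal length in its coset `w W_J`, where `W_J` is the subgroup generated by `J`. -/
def IsMinCosetRep {W : Type*} [Group W] (S J : Set W) (w : W) : Prop :=
  ∀ u ∈ Subgroup.closure J, wordLength S w ≤ wordLength S (w * u)

theorem exists_isMinCosetRep {W : Type*} [Group W] (S J : Set W) (w : W) :
    ∃ u ∈ Subgroup.closure J, IsMinCosetRep S J (w * u) := by
  let u := Function.argmin fun u : Subgroup.closure J => wordLength S (w * u)
  refine ⟨u, u.2, fun v hv => ?_⟩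
  simpa [mul_assoc] using Function.argmin_le (fun u : Subgroup.closure J => wordLength S (w * u))
    (u * ⟨v, hv⟩)

namespace IsCoxeterGenerating

variable {W : Type*} [Group W] {S J : Set W} (h : IsCoxeterGenerating S) {s t u v w : W}
include h

theorem mem_closure (w : W) : w ∈ Submonoid.closure S :=
  h.closure_eq_top ▸ Submonoid.mem_top w

theorem mul_mul_self (hs : s ∈ S) (w : W) : w * s * s = w := by
  rw [mul_assoc, h.mul_self s hs, mul_one]

theorem ne_one (hs : s ∈ S) : s ≠ 1 := by
  rintro rfl
  exact h.wordLength_mul_ne 1 hs 1 (by rw [mul_one])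

theorem wordLength_mul_le_succ (hs : s ∈ S) (w : W) :
    wordLength S (w * s) ≤ wordLength S w + 1 :=
  (wordLength_mul_le (h.mem_closure w) (h.mem_closure s)).trans
    (Nat.add_le_add_left (wordLength_le_one hs) _)

theorem wordLength_mul_eq_succ (hs : s ∈ S) (hlt : wordLength S w < wordLength S (w * s)) :
    wordLength S (w * s) = wordLength S w + 1 :=
  (h.wordLength_mul_le_succ hs w).antisymm hlt

theorem exists_sublist_of_wordLength_mul_mul_lt (hs : s ∈ S) {l : List W} (hl : ∀ x ∈ l, x ∈ S)
    (hv : wordLength S v < wordLength S (v * s))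
    (hlt : wordLength S (l.prod * v * s) < wordLength S (l.prod * v)) :
    ∃ m : List W, m.Sublist l ∧ m.length < l.length ∧ l.prod * v * s = m.prod * v := by
  induction l with
  | nil => simp only [List.prod_nil, one_mul] at hlt; omega
  | cons r l ih =>
    simp only [List.mem_cons, forall_eq_or_imp] at hl
    rcases lt_or_gt_of_ne (h.wordLength_mul_ne s hs (l.prod * v)) with hlt' | hgt
    · obtain ⟨m, hsub, hlen, e⟩ := ih hl.2 hlt'
      refine ⟨r :: m, hsub.cons_cons r, Nat.succ_lt_succ hlen, ?_⟩
      simp only [List.prod_cons, mul_assoc] at e ⊢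
      rw [e]
    · have e : r * (l.prod * v) = l.prod * v * s :=
        h.fold r hl.1 s hs _ hgt (by simpa only [List.prod_cons, mul_assoc] using hlt)
      refine ⟨l, List.sublist_cons_self r l, Nat.lt_succ_self _, ?_⟩
      rw [List.prod_cons, mul_assoc r, e, h.mul_mul_self hs]

theorem exists_sublist_of_wordLength_mul_lt (hs : s ∈ S) {l : List W} (hl : ∀ x ∈ l, x ∈ S)
    (hlt : wordLength S (l.prod * s) < wordLength S l.prod) :
    ∃ m : List W, m.Sublist l ∧ m.length < l.length ∧ l.prod * s = m.prod := by
  have hpos : wordLength S 1 < wordLength S (1 * s) := by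
    have hne := h.wordLength_mul_ne s hs 1
    rw [wordLength_one] at hne ⊢
    exact Nat.pos_of_ne_zero hne
  simpa only [mul_one] using
    h.exists_sublist_of_wordLength_mul_mul_lt (v := 1) hs hl hpos (by simpa only [mul_one])

theorem exists_word_of_mem_closure (hJ : J ⊆ S) (hu : u ∈ Subgroup.closure J) :
    ∃ l : List W, (∀ x ∈ l, x ∈ J) ∧ l.prod = u ∧ l.length = wordLength S u := by
  have extend : ∀ u, ∀ s ∈ J,
      (∃ l : List W, (∀ x ∈ l, x ∈ J) ∧ l.prod = u ∧ l.length = wordLength S u) →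
      ∃ l : List W, (∀ x ∈ l, x ∈ J) ∧ l.prod = u * s ∧ l.length = wordLength S (u * s) := by
    rintro _ s hs ⟨l, hl, rfl, hlen⟩
    rcases lt_or_gt_of_ne (h.wordLength_mul_ne s (hJ hs) l.prod) with hlt | hgt
    · obtain ⟨m, hsub, hlt, e⟩ :=
        h.exists_sublist_of_wordLength_mul_lt (hJ hs) (fun x hx => hJ (hl x hx)) hlt
      have hm : ∀ x ∈ m, x ∈ J := fun x hx => hl x (hsub.subset hx)
      have hle := wordLength_prod_le fun x hx => hJ (hm x hx)
      have hle' := h.wordLength_mul_le_succ (hJ hs) (l.prod * s)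
      rw [h.mul_mul_self (hJ hs), e] at hle'
      exact ⟨m, hm, e.symm, by rw [e]; omega⟩
    · refine ⟨l ++ [s], ?_, by simp, ?_⟩
      · simpa [or_imp, forall_and] using ⟨hl, hs⟩
      · rw [h.wordLength_mul_eq_succ (hJ hs) hgt, ← hlen, List.length_append, List.length_singleton]
  induction hu using Subgroup.closure_induction_right with
  | one => exact ⟨[], by simp, rfl, wordLength_one.symm⟩
  | mul_right u _ s hs ih => exact extend u s hs ih
  | mul_inv_cancel u _ s hs ih =>
    rw [inv_eq_of_mul_eq_one_left (h.mul_self s (hJ hs))]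
    exact extend u s hs ih

theorem closure_induction (hJ : J ⊆ S) {p : W → Prop} (one : p 1)
    (mul : ∀ u ∈ Subgroup.closure J, ∀ t ∈ J, wordLength S u < wordLength S (u * t) → p u →
      p (u * t))
    (hu : u ∈ Subgroup.closure J) : p u := by
  obtain ⟨l, hl, rfl, hlen⟩ := h.exists_word_of_mem_closure hJ hu
  clear hu
  induction l using List.reverseRecOn with
  | nil => exact one
  | append_singleton l t ih =>
    simp only [List.mem_append, List.mem_singleton, or_imp, forall_and, forall_eq] at hl
    simp only [List.prod_append, List.prod_singleton, List.length_append,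
      List.length_singleton] at hlen ⊢
    have hle := wordLength_prod_le fun x hx => hJ (hl.1 x hx)
    have hle' := h.wordLength_mul_le_succ (hJ hl.2) l.prod
    exact mul _ (Subgroup.list_prod_mem _ fun x hx => Subgroup.subset_closure (hl.1 x hx)) t hl.2
      (by omega) (ih hl.1 (by omega))

theorem exists_descent (hJ : J ⊆ S) (hu : u ∈ Subgroup.closure J) (hne : u ≠ 1) :
    ∃ t ∈ J, wordLength S (u * t) < wordLength S u := by
  revert hne
  refine h.closure_induction hJ
    (p := fun u => u ≠ 1 → ∃ t ∈ J, wordLength S (u * t) < wordLength S u)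
    (absurd rfl) (fun u _ t ht hlt _ _ => ⟨t, ht, ?_⟩) hu
  rwa [h.mul_mul_self (hJ ht)]

theorem mem_of_mem_closure (hJ : J ⊆ S) (hs : s ∈ S) (hsJ : s ∈ Subgroup.closure J) : s ∈ J := by
  obtain ⟨t, ht, hlt⟩ := h.exists_descent hJ hsJ (h.ne_one hs)
  have hst : s * t = 1 :=
    eq_one_of_wordLength_eq_zero (h.mem_closure _) (by have := wordLength_le_one hs; omega)
  rwa [← h.mul_mul_self (hJ ht) s, hst, one_mul]

theorem descent_mem_of_mem_closure (hJ : J ⊆ S) (hs : s ∈ S) (hu : u ∈ Subgroup.closure J)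
    (hlt : wordLength S (u * s) < wordLength S u) : s ∈ J := by
  obtain ⟨l, hl, rfl, -⟩ := h.exists_word_of_mem_closure hJ hu
  obtain ⟨m, hsub, -, e⟩ :=
    h.exists_sublist_of_wordLength_mul_lt hs (fun x hx => hJ (hl x hx)) hlt
  have hm : m.prod ∈ Subgroup.closure J :=
    Subgroup.list_prod_mem _ fun x hx => Subgroup.subset_closure (hl x (hsub.subset hx))
  rw [← e, Subgroup.mul_mem_cancel_left _ hu] at hm
  exact h.mem_of_mem_closure hJ hs hm

theorem mem_closure_inter_iInter {ι : Type*} {I : ι → Set W} (hI : ∀ i, I i ⊆ S)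
    (hu : ∀ i, u ∈ Subgroup.closure (I i)) : u ∈ Subgroup.closure (S ∩ ⋂ i, I i) := by
  revert hu
  refine h.closure_induction subset_rfl
    (p := fun u => (∀ i, u ∈ Subgroup.closure (I i)) → u ∈ Subgroup.closure (S ∩ ⋂ i, I i))
    (fun _ => one_mem _) (fun u _ t ht hlt ih hu => ?_)
    (Subgroup.le_closure_toSubmonoid S (h.mem_closure u))
  have htI : ∀ i, t ∈ I i := fun i =>
    h.descent_mem_of_mem_closure (hI i) ht (hu i) (by rwa [h.mul_mul_self ht])
  have huI : ∀ i, u ∈ Subgroup.closure (I i) := fun i =>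
    (Subgroup.mul_mem_cancel_right _ (Subgroup.subset_closure (htI i))).1 (hu i)
  exact mul_mem (ih huI) (Subgroup.subset_closure ⟨ht, Set.mem_iInter.2 htI⟩)

theorem wordLength_mul_lt_mul_mul (hJ : J ⊆ S) (hw : IsMinCosetRep S J w)
    (hu : u ∈ Subgroup.closure J) (ht : t ∈ J) (hlt : wordLength S u < wordLength S (u * t)) :
    wordLength S (w * u) < wordLength S (w * u * t) := by
  refine (h.wordLength_mul_ne t (hJ ht) (w * u)).lt_or_gt.resolve_left fun hgt => ?_
  obtain ⟨l, hl, rfl, hlen⟩ := exists_word_length_eq_wordLength (h.mem_closure w)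
  obtain ⟨m, hsub, hlt', e⟩ :=
    h.exists_sublist_of_wordLength_mul_mul_lt (hJ ht) hl hlt hgt
  have hmin := hw (u * t * u⁻¹) (mul_mem (mul_mem hu (Subgroup.subset_closure ht)) (inv_mem hu))
  rw [← mul_assoc, ← mul_assoc, e, mul_inv_cancel_right] at hmin
  have hle := wordLength_prod_le fun x hx => hl x (hsub.subset hx)
  omega

theorem wordLength_mul_of_isMinCosetRep (hJ : J ⊆ S) (hw : IsMinCosetRep S J w)
    (hu : u ∈ Subgroup.closure J) :
    wordLength S (w * u) = wordLength S w + wordLength S u := by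
  refine h.closure_induction hJ
    (p := fun u => wordLength S (w * u) = wordLength S w + wordLength S u)
    (by rw [mul_one, wordLength_one, add_zero]) (fun u hu t ht hlt ih => ?_) hu
  rw [h.wordLength_mul_eq_succ (hJ ht) hlt, ← mul_assoc, h.wordLength_mul_eq_succ (hJ ht)
    (h.wordLength_mul_lt_mul_mul hJ hw hu ht hlt), ih, add_assoc]

theorem isMinCosetRep_of_forall_lt (hJ : J ⊆ S)
    (hw : ∀ t ∈ J, wordLength S w < wordLength S (w * t)) : IsMinCosetRep S J w := by
  obtain ⟨u, hu, hmin⟩ := exists_isMinCosetRep S J w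
  rcases eq_or_ne u⁻¹ 1 with hu1 | hne
  · rwa [inv_eq_one.1 hu1, mul_one] at hmin
  obtain ⟨t, ht, hlt⟩ := h.exists_descent hJ (inv_mem hu) hne
  have hlt' := h.wordLength_mul_lt_mul_mul hJ hmin
    (mul_mem (inv_mem hu) (Subgroup.subset_closure ht)) ht (by rwa [h.mul_mul_self (hJ ht)])
  rw [show w * u * (u⁻¹ * t) = w * t by group, h.mul_mul_self (hJ ht)] at hlt'
  exact absurd hlt' (hw t ht).not_gt

theorem wordLength_lt_of_isMinCosetRep (hJ : J ⊆ S) (hw : IsMinCosetRep S J w)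
    (hu : u ∈ Subgroup.closure J) (hne : u ≠ 1) : wordLength S w < wordLength S (w * u) := by
  rw [h.wordLength_mul_of_isMinCosetRep hJ hw hu, Nat.lt_add_right_iff_pos, Nat.pos_iff_ne_zero]
  exact fun h0 => hne (eq_one_of_wordLength_eq_zero (h.mem_closure u) h0)

end IsCoxeterGenerating

namespace BNPair

variable {G : Type u} [Group G] (P : BNPair G) {J T : Set P.S} {s u v w : P.Weyl} {b g x : G}

/-- The Bruhat cell `B w B`, the union of the double cosets `B n B` over all representatives `n`
of `w` in `N`. -/
def cell (w : P.Weyl) : Set G :=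
  {g | ∃ n : P.N, (n : P.Weyl) = w ∧ ∃ b ∈ P.B, ∃ c ∈ P.B, g = b * n * c}

theorem coe_mem_cell (n : P.N) : (n : G) ∈ P.cell (n : P.Weyl) :=
  ⟨n, rfl, 1, one_mem _, 1, one_mem _, by simp⟩

theorem left_mul_mem_cell (hb : b ∈ P.B) (hg : g ∈ P.cell w) : b * g ∈ P.cell w := by
  obtain ⟨n, hn, c, hc, d, hd, rfl⟩ := hg
  exact ⟨n, hn, b * c, P.B.mul_mem hb hc, d, hd, by simp only [mul_assoc]⟩

theorem inv_mem_cell (hg : g ∈ P.cell w) : g⁻¹ ∈ P.cell w⁻¹ := by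
  obtain ⟨n, rfl, b, hb, c, hc, rfl⟩ := hg
  exact ⟨n⁻¹, rfl, c⁻¹, inv_mem hc, b⁻¹, inv_mem hb, by simp [mul_assoc]⟩

theorem right_mul_mem_cell (hg : g ∈ P.cell w) (hb : b ∈ P.B) : g * b ∈ P.cell w := by
  simpa using P.inv_mem_cell (P.left_mul_mem_cell (inv_mem hb) (P.inv_mem_cell hg))

theorem coe_eq_one_iff {n : P.N} : (n : P.Weyl) = 1 ↔ (n : G) ∈ P.B := by
  rw [QuotientGroup.eq_one_iff, Subgroup.mem_subgroupOf]

theorem eq_one_iff_of_mem_cell (hg : g ∈ P.cell w) : w = 1 ↔ g ∈ P.B := by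
  obtain ⟨n, rfl, b, hb, c, hc, rfl⟩ := hg
  rw [P.B.mul_mem_cancel_right hc, P.B.mul_mem_cancel_left hb, coe_eq_one_iff]

theorem mem_cell_one_iff : g ∈ P.cell 1 ↔ g ∈ P.B :=
  ⟨fun hg => (P.eq_one_iff_of_mem_cell hg).1 rfl,
    fun hg => by simpa using P.left_mul_mem_cell hg (P.coe_mem_cell 1)⟩

theorem cell_nonempty (w : P.Weyl) : (P.cell w).Nonempty := by
  obtain ⟨n, rfl⟩ := QuotientGroup.mk_surjective w
  exact ⟨n, P.coe_mem_cell n⟩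

theorem exists_mul_eq_of_mem_cell_mul (hg : g ∈ P.cell (v * u)) :
    ∃ x ∈ P.cell v, ∃ y ∈ P.cell u, x * y = g := by
  obtain ⟨m, rfl⟩ := QuotientGroup.mk_surjective u
  obtain ⟨n, hn, b, hb, c, hc, rfl⟩ := hg
  refine ⟨b * (n * m⁻¹ : P.N), P.left_mul_mem_cell hb ?_, m * c,
    P.right_mul_mem_cell (P.coe_mem_cell m) hc, by simp [mul_assoc]⟩
  simpa [hn] using P.coe_mem_cell (n * m⁻¹)

theorem S_mul_self (hs : s ∈ P.S) : s * s = 1 := by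
  rw [← pow_two, ← P.orderOf_S s hs, pow_orderOf_eq_one]

theorem S_inv_eq_self (hs : s ∈ P.S) : s⁻¹ = s :=
  inv_eq_of_mul_eq_one_left (P.S_mul_self hs)

theorem S_ne_one (hs : s ∈ P.S) : s ≠ 1 := by
  rintro rfl
  simpa using P.orderOf_S 1 hs

theorem submonoid_closure_S : Submonoid.closure P.S = ⊤ := by
  have hinv : P.S⁻¹ ⊆ P.S := fun s hs => by
    rwa [← inv_inv s, P.S_inv_eq_self (Set.mem_inv.1 hs)]
  rw [← Set.union_eq_self_of_subset_right hinv, ← Subgroup.closure_toSubmonoid, P.closure_S,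
    Subgroup.top_toSubmonoid]

theorem mem_submonoid_closure_S (w : P.Weyl) : w ∈ Submonoid.closure P.S :=
  P.submonoid_closure_S ▸ Submonoid.mem_top w

theorem inv_mem_cell_of_mem_S (hs : s ∈ P.S) (hx : x ∈ P.cell s) : x⁻¹ ∈ P.cell s := by
  simpa only [P.S_inv_eq_self hs] using P.inv_mem_cell hx

theorem gen_mul_mem_cell_or (hs : s ∈ P.S) (hx : x ∈ P.cell s) (hg : g ∈ P.cell w) :
    x * g ∈ P.cell (s * w) ∨ x * g ∈ P.cell w := by
  obtain ⟨n, rfl, b, hb, c, hc, rfl⟩ := hx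
  obtain ⟨m, rfl, d, hd, e, he, rfl⟩ := hg
  rw [show b * n * c * (d * m * e) = b * ((n * (c * d) * m) * e) by simp only [mul_assoc]]
  refine (P.mul_mem n m hs (c * d) (P.B.mul_mem hc hd)).imp (fun h => ?_) fun h => ?_ <;>
    refine P.left_mul_mem_cell hb (P.right_mul_mem_cell ?_ he)
  · exact ⟨n * m, rfl, DoubleCoset.mem_doubleCoset.1 h⟩
  · exact ⟨m, rfl, DoubleCoset.mem_doubleCoset.1 h⟩

theorem mul_gen_mem_cell_or (hs : s ∈ P.S) (hg : g ∈ P.cell w) (hx : x ∈ P.cell s) :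
    g * x ∈ P.cell (w * s) ∨ g * x ∈ P.cell w := by
  have h := P.gen_mul_mem_cell_or hs (P.inv_mem_cell_of_mem_S hs hx) (P.inv_mem_cell hg)
  rw [← mul_inv_rev] at h
  refine h.imp (fun h => ?_) (fun h => by simpa using P.inv_mem_cell h)
  simpa [P.S_inv_eq_self hs] using P.inv_mem_cell h

theorem exists_gen_mul_gen_mem_cell (hs : s ∈ P.S) :
    ∃ x ∈ P.cell s, ∃ y ∈ P.cell s, x * y ∈ P.cell s := by
  obtain ⟨n, rfl⟩ := QuotientGroup.mk_surjective s
  obtain ⟨b, hb, h⟩ := P.not_le n hs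
  have hx := P.right_mul_mem_cell (P.coe_mem_cell n) hb
  have hy := P.inv_mem_cell_of_mem_S hs (P.coe_mem_cell n)
  refine ⟨_, hx, _, hy, (P.gen_mul_mem_cell_or hs hx hy).resolve_left fun hxy => h ?_⟩
  rwa [P.S_mul_self hs, mem_cell_one_iff] at hxy

theorem mem_parabolic_iff : g ∈ P.parabolic J ↔ ∃ w ∈ P.weylParabolic J, g ∈ P.cell w := by
  constructor
  · rintro ⟨n, hn, h⟩
    exact ⟨n, hn, n, rfl, DoubleCoset.mem_doubleCoset.1 h⟩
  · rintro ⟨w, hw, n, rfl, h⟩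
    exact ⟨n, hw, DoubleCoset.mem_doubleCoset.2 h⟩

theorem B_le_parabolic (J : Set P.S) : P.B ≤ P.parabolic J := fun _ hb =>
  P.mem_parabolic_iff.2 ⟨1, one_mem _, P.mem_cell_one_iff.2 hb⟩

theorem exists_mem_cell (g : G) : ∃ w, g ∈ P.cell w := by
  have hW : P.weylParabolic Set.univ = ⊤ := by
    rw [weylParabolic, Set.image_univ, Subtype.range_coe, P.closure_S]
  have hG : P.parabolic Set.univ = ⊤ := by
    rw [eq_top_iff, ← P.sup_eq_top, sup_le_iff]
    exact ⟨P.B_le_parabolic _, fun n hn => P.mem_parabolic_iff.2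
      ⟨((⟨n, hn⟩ : P.N) : P.Weyl), hW ▸ Subgroup.mem_top _, P.coe_mem_cell ⟨n, hn⟩⟩⟩
  obtain ⟨w, -, hw⟩ := P.mem_parabolic_iff.1 (hG ▸ Subgroup.mem_top g : g ∈ P.parabolic Set.univ)
  exact ⟨w, hw⟩

theorem wordLength_gen_mul_le (hs : s ∈ P.S) (w : P.Weyl) :
    wordLength P.S (s * w) ≤ wordLength P.S w + 1 := by
  have hle := wordLength_mul_le (P.mem_submonoid_closure_S s) (P.mem_submonoid_closure_S w)
  have hs := wordLength_le_one hs
  omega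

theorem exists_eq_gen_mul (hw : wordLength P.S w ≠ 0) :
    ∃ s ∈ P.S, ∃ v, w = s * v ∧ wordLength P.S w = wordLength P.S v + 1 :=
  exists_eq_mul_wordLength_eq_succ (P.mem_submonoid_closure_S w)
    (by rintro rfl; exact hw wordLength_one)

theorem cell_unique (hv : g ∈ P.cell v) (hw : g ∈ P.cell w) : v = w := by
  wlog hl : wordLength P.S v ≤ wordLength P.S w generalizing v w
  · exact (this hw hv (le_of_not_ge hl)).symm
  induction hk : wordLength P.S v generalizing v w g with
  | zero =>
    obtain rfl := eq_one_of_wordLength_eq_zero (P.mem_submonoid_closure_S v) hk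
    exact ((P.eq_one_iff_of_mem_cell hw).2 (P.mem_cell_one_iff.1 hv)).symm
  | succ k ih =>
    obtain ⟨s, hs, v, rfl, hlv⟩ := P.exists_eq_gen_mul (w := v) (by omega)
    obtain ⟨x, hx, y, hy, rfl⟩ := P.exists_mul_eq_of_mem_cell_mul hv
    have hss : s * (s * w) = w := by rw [← mul_assoc, P.S_mul_self hs, one_mul]
    have hle := hss ▸ P.wordLength_gen_mul_le hs (s * w)
    have hy' := P.gen_mul_mem_cell_or hs (P.inv_mem_cell_of_mem_S hs hx) hw
    rw [inv_mul_cancel_left] at hy'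
    rcases hy' with hy' | hy'
    · rw [ih hy hy' (by omega) (by omega), hss]
    · obtain rfl := ih hy hy' (by omega) (by omega)
      omega

theorem mul_gen_mem_cell (hs : s ∈ P.S) (hl : wordLength P.S w ≤ wordLength P.S (w * s))
    (hg : g ∈ P.cell w) (hx : x ∈ P.cell s) : g * x ∈ P.cell (w * s) := by
  induction hk : wordLength P.S w generalizing w g with
  | zero =>
    obtain rfl := eq_one_of_wordLength_eq_zero (P.mem_submonoid_closure_S w) hk
    rw [mem_cell_one_iff] at hg
    rw [one_mul]
    exact P.left_mul_mem_cell hg hx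
  | succ k ih =>
    refine (P.mul_gen_mem_cell_or hs hg hx).elim id fun hgx => ?_
    exfalso
    obtain ⟨t, ht, v, rfl, hlv⟩ := P.exists_eq_gen_mul (w := w) (by omega)
    obtain ⟨y, hy, z, hz, rfl⟩ := P.exists_mul_eq_of_mem_cell_mul hg
    have htt : t * (t * v) = v := by rw [← mul_assoc, P.S_mul_self ht, one_mul]
    have hle := P.wordLength_gen_mul_le ht (v * s)
    rw [← mul_assoc] at hle
    have hzx : z * x ∈ P.cell (v * s) := ih (by omega) hz (by omega)
    have hzx' := P.gen_mul_mem_cell_or ht (P.inv_mem_cell_of_mem_S ht hy) hgx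
    rw [htt, mul_assoc, inv_mul_cancel_left] at hzx'
    rcases hzx' with hzx' | hzx'
    · exact P.S_ne_one hs (by simpa using P.cell_unique hzx hzx')
    · rw [mul_assoc, P.cell_unique hzx hzx', htt] at hl
      omega

theorem exists_mul_gen_mem_cell (hs : s ∈ P.S)
    (hl : wordLength P.S w ≤ wordLength P.S (w * s)) :
    ∃ g ∈ P.cell (w * s), ∃ x ∈ P.cell s, g * x ∈ P.cell (w * s) := by
  obtain ⟨x, hx, y, hy, hxy⟩ := P.exists_gen_mul_gen_mem_cell hs
  obtain ⟨z, hz⟩ := P.cell_nonempty w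
  refine ⟨z * x, P.mul_gen_mem_cell hs hl hz hx, y, hy, ?_⟩
  rw [mul_assoc]
  exact P.mul_gen_mem_cell hs hl hz hxy

theorem isCoxeterGenerating : IsCoxeterGenerating P.S where
  closure_eq_top := P.submonoid_closure_S
  mul_self _ := P.S_mul_self
  wordLength_mul_ne s hs w hl := by
    obtain ⟨g, hg, x, hx, hgx⟩ := P.exists_mul_gen_mem_cell hs hl.ge
    have hss : w * s * s = w := by rw [mul_assoc, P.S_mul_self hs, mul_one]
    have hgx' := P.mul_gen_mem_cell hs (by rw [hss, hl]) hg hx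
    exact P.S_ne_one hs (by simpa [mul_assoc] using P.cell_unique hgx hgx')
  fold s hs t ht w hlt hlt' := by
    have htt : s * w * t * t = s * w := by rw [mul_assoc, P.S_mul_self ht, mul_one]
    obtain ⟨g, hg, x, hx, hgx⟩ := P.exists_mul_gen_mem_cell ht (by rw [htt]; exact hlt'.le)
    rw [htt] at hg hgx
    obtain ⟨y, hy, z, hz, rfl⟩ := P.exists_mul_eq_of_mem_cell_mul hg
    have hzx : z * x ∈ P.cell (w * t) := P.mul_gen_mem_cell ht hlt.le hz hx
    have hzx' := P.gen_mul_mem_cell_or hs (P.inv_mem_cell_of_mem_S hs hy) hgx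
    rw [← mul_assoc s s, P.S_mul_self hs, one_mul, mul_assoc, inv_mul_cancel_left] at hzx'
    rcases hzx' with hzx' | hzx'
    · exact absurd (by simpa using P.cell_unique hzx hzx') (P.S_ne_one ht)
    · exact (P.cell_unique hzx hzx').symm

theorem mem_parabolic_iff_of_mem_cell (hg : g ∈ P.cell w) :
    g ∈ P.parabolic J ↔ w ∈ P.weylParabolic J := by
  rw [mem_parabolic_iff]
  exact ⟨fun ⟨_, hv, hgv⟩ => P.cell_unique hg hgv ▸ hv, fun hw => ⟨w, hw, hg⟩⟩

theorem mem_weylParabolic_compl (hw : ∀ s ∈ T, w ∈ P.weylParabolic {s}ᶜ) :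
    w ∈ P.weylParabolic Tᶜ := by
  have hw' := P.isCoxeterGenerating.mem_closure_inter_iInter (ι := T)
    (fun s => Subtype.coe_image_subset P.S {s.1}ᶜ) fun s => hw s s.2
  refine Subgroup.closure_mono ?_ hw'
  rintro t ⟨ht, htT⟩
  refine ⟨⟨t, ht⟩, fun hmem => ?_, rfl⟩
  obtain ⟨t', ht', rfl⟩ := Set.mem_iInter.1 htT ⟨_, hmem⟩
  exact ht' rfl

theorem mem_parabolic_compl (hg : ∀ s ∈ T, g ∈ P.parabolic {s}ᶜ) : g ∈ P.parabolic Tᶜ := by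
  obtain ⟨w, hw⟩ := P.exists_mem_cell g
  simp only [P.mem_parabolic_iff_of_mem_cell hw] at hg ⊢
  exact P.mem_weylParabolic_compl hg

theorem mul_mem_cell_of_isMinCosetRep (hw : IsMinCosetRep P.S (Subtype.val '' J) w)
    (hu : u ∈ P.weylParabolic J) (hg : g ∈ P.cell w) (hx : x ∈ P.cell u) :
    g * x ∈ P.cell (w * u) := by
  have hJ := Subtype.coe_image_subset P.S J
  refine P.isCoxeterGenerating.closure_induction hJ
    (p := fun u => ∀ x ∈ P.cell u, g * x ∈ P.cell (w * u))
    (fun x hx => ?_) (fun u hu t ht hlt ih x hx => ?_) hu x hx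
  · rw [mul_one]
    exact P.right_mul_mem_cell hg (P.mem_cell_one_iff.1 hx)
  · obtain ⟨y, hy, z, hz, rfl⟩ := P.exists_mul_eq_of_mem_cell_mul hx
    rw [← mul_assoc, ← mul_assoc]
    exact P.mul_gen_mem_cell (hJ ht)
      (P.isCoxeterGenerating.wordLength_mul_lt_mul_mul hJ hw hu ht hlt).le (ih y hy) hz

theorem exists_mul_mem_cell (hg : g ∈ P.cell w) (hx : x ∈ P.parabolic J) :
    ∃ u ∈ P.weylParabolic J, g * x ∈ P.cell (w * u) := by
  obtain ⟨v, hv, hx⟩ := P.mem_parabolic_iff.1 hx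
  refine P.isCoxeterGenerating.closure_induction (Subtype.coe_image_subset P.S J)
    (p := fun v => ∀ x ∈ P.cell v, ∃ u ∈ P.weylParabolic J, g * x ∈ P.cell (w * u))
    (fun x hx => ?_) (fun v _ t ht _ ih x hx => ?_) hv x hx
  · exact ⟨1, one_mem _, by
      simpa only [mul_one] using P.right_mul_mem_cell hg (P.mem_cell_one_iff.1 hx)⟩
  · obtain ⟨y, hy, z, hz, rfl⟩ := P.exists_mul_eq_of_mem_cell_mul hx
    obtain ⟨u, hu, hgy⟩ := ih y hy
    rw [← mul_assoc]
    rcases P.mul_gen_mem_cell_or (Subtype.coe_image_subset P.S J ht) hgy hz with hgx | hgx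
    · have hut := (P.weylParabolic J).mul_mem hu (Subgroup.subset_closure ht)
      exact ⟨u * t, hut, by rwa [← mul_assoc]⟩
    · exact ⟨u, hu, hgx⟩

end BNPair

section Chains

variable {V : Type*} {A A' : Set (Finset V)} {C R : Set V} {i : ℤ} {z : Finset V →₀ ZMod 2} {v : V}

/-- The `i`-chains supported on a family `A` of finite sets, such as the simplices of a simplicial
complex together with the empty set. -/
def chainsOn (A : Set (Finset V)) (i : ℤ) : Submodule (ZMod 2) (Finset V →₀ ZMod 2) :=
  Finsupp.supported (ZMod 2) (ZMod 2) {σ | σ ∈ A ∧ (σ.card : ℤ) = i + 1}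

theorem chainsOn_mono (h : A ⊆ A') (i : ℤ) : chainsOn A i ≤ chainsOn A' i :=
  Finsupp.supported_mono fun _ hσ => ⟨h hσ.1, hσ.2⟩

theorem chainsOn_union (A A' : Set (Finset V)) (i : ℤ) :
    chainsOn (A ∪ A') i = chainsOn A i ⊔ chainsOn A' i := by
  rw [chainsOn, chainsOn, chainsOn, ← Finsupp.supported_union]
  congr 1
  ext σ
  exact or_and_right

variable [DecidableEq V]

/-- The boundary operator on augmented mod 2 chains of the full simplex on `V`; the chains of every
simplicial complex with vertices in `V` live in this one space. -/
noncomputable def simplexBoundary : (Finset V →₀ ZMod 2) →ₗ[ZMod 2] (Finset V →₀ ZMod 2) :=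
  Finsupp.linearCombination (ZMod 2) fun σ => ∑ v ∈ σ, Finsupp.single (σ.erase v) 1

/-- The cone operator with apex `v`, which kills the simplices containing `v`. -/
noncomputable def simplexCone (v : V) : (Finset V →₀ ZMod 2) →ₗ[ZMod 2] (Finset V →₀ ZMod 2) :=
  Finsupp.linearCombination (ZMod 2) fun σ =>
    if v ∈ σ then 0 else Finsupp.single (insert v σ) 1

theorem simplexBoundary_single (σ : Finset V) :
    simplexBoundary (Finsupp.single σ 1) = ∑ v ∈ σ, Finsupp.single (σ.erase v) (1 : ZMod 2) := by
  simp [simplexBoundary]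

theorem simplexCone_single (v : V) (σ : Finset V) :
    simplexCone v (Finsupp.single σ 1) =
      if v ∈ σ then 0 else Finsupp.single (insert v σ) (1 : ZMod 2) := by
  simp [simplexCone]

theorem simplexBoundary_simplexCone_add (v : V) (z : Finset V →₀ ZMod 2) :
    simplexBoundary (simplexCone v z) + simplexCone v (simplexBoundary z) = z := by
  suffices H : simplexBoundary ∘ₗ simplexCone v + simplexCone v ∘ₗ simplexBoundary =
      LinearMap.id from LinearMap.congr_fun H z
  refine Finsupp.lhom_ext' fun σ => LinearMap.ext_ring ?_
  simp only [LinearMap.add_apply, LinearMap.comp_apply, Finsupp.lsingle_apply, LinearMap.id_apply,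
    simplexBoundary_single, simplexCone_single, map_sum]
  by_cases hv : v ∈ σ
  · rw [if_pos hv, map_zero, zero_add, Finset.sum_eq_single_of_mem v hv]
    · simp [Finset.insert_erase hv]
    · intro u _ hu
      rw [if_pos (Finset.mem_erase.2 ⟨hu.symm, hv⟩)]
  · rw [if_neg hv, simplexBoundary_single, Finset.sum_insert hv, Finset.erase_insert hv, add_assoc,
      ← Finset.sum_add_distrib, Finset.sum_eq_zero, add_zero]
    intro u hu
    have hvu : v ≠ u := (ne_of_mem_of_not_mem hu hv).symm
    rw [if_neg (fun h => hv (Finset.mem_of_mem_erase h)), Finset.erase_insert_of_ne hvu,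
      ZModModule.add_self]

theorem simplexBoundary_simplexBoundary (z : Finset V →₀ ZMod 2) :
    simplexBoundary (simplexBoundary z) = 0 := by
  suffices H : simplexBoundary ∘ₗ simplexBoundary = (0 : (Finset V →₀ ZMod 2) →ₗ[ZMod 2] _) from
    LinearMap.congr_fun H z
  refine Finsupp.lhom_ext' fun σ => LinearMap.ext_ring ?_
  simp only [LinearMap.comp_apply, Finsupp.lsingle_apply, LinearMap.zero_apply]
  -- A nonempty simplex is a cone, and the cone identity carries `∂∂ = 0` from its base to it.
  induction σ using Finset.induction_on with
  | empty => simp [simplexBoundary_single]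
  | insert v σ hv ih =>
    have hcone : Finsupp.single (insert v σ) (1 : ZMod 2) = simplexCone v (Finsupp.single σ 1) := by
      rw [simplexCone_single, if_neg hv]
    have hσ := eq_sub_of_add_eq (simplexBoundary_simplexCone_add v (Finsupp.single σ 1))
    have hbase := simplexBoundary_simplexCone_add v (simplexBoundary (Finsupp.single σ 1))
    rw [ih, map_zero, add_zero] at hbase
    rw [hcone, hσ, map_sub, hbase, sub_self]

theorem simplexBoundary_mem_chainsOn (hA : IsLowerSet A) (hz : z ∈ chainsOn A i) :
    simplexBoundary z ∈ chainsOn A (i - 1) := by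
  rw [simplexBoundary, Finsupp.linearCombination_apply]
  refine Submodule.sum_mem _ fun σ hσ => Submodule.smul_mem _ _ <|
    Submodule.sum_mem _ fun v hv => Finsupp.single_mem_supported _ _
      ⟨hA (σ.erase_subset v) (hz hσ).1, ?_⟩
  have := Finset.card_erase_add_one hv
  have := (hz hσ).2
  lia

theorem simplexCone_mem_chainsOn (h : ∀ σ ∈ A, insert v σ ∈ A') (hz : z ∈ chainsOn A i) :
    simplexCone v z ∈ chainsOn A' (i + 1) := by
  rw [simplexCone, Finsupp.linearCombination_apply]
  refine Submodule.sum_mem _ fun σ hσ => Submodule.smul_mem _ _ ?_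
  split_ifs with hv
  · exact zero_mem _
  · refine Finsupp.single_mem_supported _ _ ⟨h σ (hz hσ).1, ?_⟩
    rw [Finset.card_insert_of_notMem hv, Nat.cast_succ, (hz hσ).2]

/-- The reduced mod 2 homology of `A` vanishes in degree `i`: every `i`-cycle is a boundary. -/
def IsAcyclicAt (A : Set (Finset V)) (i : ℤ) : Prop :=
  ∀ z ∈ chainsOn A i, simplexBoundary z = 0 → ∃ y ∈ chainsOn A (i + 1), simplexBoundary y = z

/-- The cone over the part of `z` in `C`, with apex a vertex `v` of `C` not in `R`, pushes `z`
into `A`, because adding `v` to a set cannot make it contain `R`. -/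
theorem exists_add_simplexBoundary_mem_chainsOn (hA : IsLowerSet A) (hCR : ¬ C ⊆ R)
    (hAC : ∀ σ : Finset V, ↑σ ⊆ C → (σ ∈ A ↔ ¬ R ⊆ σ))
    (hz : z ∈ chainsOn (A ∪ {σ | ↑σ ⊆ C}) i) (hz0 : simplexBoundary z = 0) :
    ∃ y ∈ chainsOn (A ∪ {σ | ↑σ ⊆ C}) (i + 1), z + simplexBoundary y ∈ chainsOn A i := by
  obtain ⟨v, hvC, hvR⟩ := Set.not_subset.1 hCR
  have hins : ∀ σ : Finset V, ↑σ ⊆ C → ↑(insert v σ) ⊆ C := fun σ hσ => by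
    rw [Finset.coe_insert]
    exact Set.insert_subset hvC hσ
  rw [chainsOn_union] at hz
  obtain ⟨old, hold, new, hnew, rfl⟩ := Submodule.mem_sup.1 hz
  have hboundary : simplexBoundary new ∈ chainsOn (A ∩ {σ | ↑σ ⊆ C}) (i - 1) := by
    have heq : simplexBoundary new = simplexBoundary old := by
      rw [map_add, add_comm] at hz0
      rw [← sub_eq_zero, ZModModule.sub_eq_add, hz0]
    have hbA := simplexBoundary_mem_chainsOn hA hold
    have hbC := simplexBoundary_mem_chainsOn
      (fun σ τ hτσ hσ => (Finset.coe_subset.2 hτσ).trans hσ) hnew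
    rw [← heq] at hbA
    exact fun σ hσ => ⟨⟨(hbA hσ).1, (hbC hσ).1⟩, (hbC hσ).2⟩
  have hcone : simplexCone v (simplexBoundary new) ∈ chainsOn A i := by
    rw [← sub_add_cancel i 1]
    refine simplexCone_mem_chainsOn ?_ hboundary
    rintro σ ⟨hσA, hσC⟩
    rw [hAC _ (hins σ hσC), Finset.coe_insert, Set.subset_insert_iff_of_notMem hvR]
    exact (hAC σ hσC).1 hσA
  refine ⟨simplexCone v new, chainsOn_mono Set.subset_union_right _
    (simplexCone_mem_chainsOn hins hnew), ?_⟩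
  convert add_mem hold hcone using 1
  calc old + new + simplexBoundary (simplexCone v new)
      = old + (simplexBoundary (simplexCone v new) + simplexCone v (simplexBoundary new)) +
          simplexBoundary (simplexCone v new) := by rw [simplexBoundary_simplexCone_add]
    _ = old + simplexCone v (simplexBoundary new) +
          (simplexBoundary (simplexCone v new) + simplexBoundary (simplexCone v new)) := by abel
    _ = old + simplexCone v (simplexBoundary new) := by rw [ZModModule.add_self, add_zero]

theorem IsAcyclicAt.union_powerset (hacyc : IsAcyclicAt A i) (hA : IsLowerSet A)
    (hC : ∀ σ : Finset V, C ⊆ σ → i + 1 < σ.card)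
    (hAC : ∀ σ : Finset V, ↑σ ⊆ C → (σ ∈ A ↔ ¬ R ⊆ σ)) :
    IsAcyclicAt (A ∪ {σ | ↑σ ⊆ C}) i := by
  intro z hz hz0
  by_cases hCR : C ⊆ R
  · have hzA : z ∈ chainsOn A i := fun σ hσ => by
      refine ⟨(hz hσ).1.elim id fun hσC => (hAC σ hσC).2 fun hR => ?_, (hz hσ).2⟩
      exact (hC σ (hCR.trans hR)).ne' (hz hσ).2
    obtain ⟨y, hy, hyz⟩ := hacyc z hzA hz0
    exact ⟨y, chainsOn_mono Set.subset_union_left _ hy, hyz⟩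
  · obtain ⟨x, hx, hzx⟩ := exists_add_simplexBoundary_mem_chainsOn hA hCR hAC hz hz0
    obtain ⟨y, hy, hyz⟩ := hacyc _ hzx (by
      rw [map_add, hz0, simplexBoundary_simplexBoundary, add_zero])
    refine ⟨y + x, add_mem (chainsOn_mono Set.subset_union_left _ hy) hx, ?_⟩
    rw [map_add, hyz, add_assoc, ZModModule.add_self, add_zero]

end Chains

/-- The simplices with vertex sets `C j`, `j ∈ D`, added in the order of increasing `ℓ`, form a
shelling in which `R j` is the smallest face of `C j` that is new when `C j` is added. Simplices
with equal `ℓ` may be added in any order. -/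
structure IsShelling {ι V : Type*} (C R : ι → Set V) (ℓ : ι → ℕ) (D : Set ι) : Prop where
  diff_singleton_subset : ∀ j ∈ D, ∀ v ∈ R j, ∃ k ∈ D, ℓ k < ℓ j ∧ C j \ {v} ⊆ C k
  not_subset : ∀ j ∈ D, ∀ k ∈ D, k ≠ j → ℓ k ≤ ℓ j → ¬ R j ⊆ C k

namespace IsShelling

variable {ι V : Type*} {C R : ι → Set V} {ℓ : ι → ℕ} {D : Set ι} {i : ℤ}

theorem setOf_le (h : IsShelling C R ℓ D) (a : ℕ) : IsShelling C R ℓ {j ∈ D | ℓ j ≤ a} where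
  diff_singleton_subset j hj v hv := by
    obtain ⟨k, hk, hlt, hsub⟩ := h.diff_singleton_subset j hj.1 v hv
    exact ⟨k, ⟨hk, hlt.le.trans hj.2⟩, hlt, hsub⟩
  not_subset j hj k hk := h.not_subset j hj.1 k hk.1

theorem of_insert {a : ι} (h : IsShelling C R ℓ (insert a D)) (ha : ∀ j ∈ D, ℓ j ≤ ℓ a) :
    IsShelling C R ℓ D where
  diff_singleton_subset j hj v hv := by
    obtain ⟨k, hk, hlt, hsub⟩ := h.diff_singleton_subset j (Set.mem_insert_of_mem a hj) v hv
    exact ⟨k, hk.resolve_left (by rintro rfl; exact (ha j hj).not_gt hlt), hlt, hsub⟩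
  not_subset j hj k hk := h.not_subset j (Set.mem_insert_of_mem a hj) k (Set.mem_insert_of_mem a hk)

theorem exists_subset_iff_of_insert {a : ι} (h : IsShelling C R ℓ (insert a D)) (haD : a ∉ D)
    (ha : ∀ j ∈ D, ℓ j ≤ ℓ a) {σ : Set V} (hσ : σ ⊆ C a) :
    (∃ j ∈ D, σ ⊆ C j) ↔ ¬ R a ⊆ σ := by
  constructor
  · rintro ⟨j, hj, hσj⟩ hR
    exact h.not_subset a (Set.mem_insert a D) j (Set.mem_insert_of_mem a hj)
      (ne_of_mem_of_not_mem hj haD) (ha j hj) (hR.trans hσj)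
  · intro hR
    obtain ⟨v, hvR, hvσ⟩ := Set.not_subset.1 hR
    obtain ⟨j, hj, hlt, hsub⟩ := h.diff_singleton_subset a (Set.mem_insert a D) v hvR
    exact ⟨j, hj.resolve_left (by rintro rfl; exact lt_irrefl _ hlt),
      (Set.subset_sdiff_singleton hσ hvσ).trans hsub⟩

variable [DecidableEq V]

theorem isAcyclicAt_of_finset {D : Finset ι} (h : IsShelling C R ℓ D)
    (hC : ∀ j ∈ D, ∀ σ : Finset V, C j ⊆ σ → i + 1 < σ.card) :
    IsAcyclicAt {σ : Finset V | ∃ j ∈ D, ↑σ ⊆ C j} i := by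
  classical
  induction D using Finset.induction_on_max_value ℓ with
  | empty =>
    intro z hz _
    have hz0 : z = 0 := by simpa [chainsOn] using hz
    exact ⟨0, zero_mem _, by simp [hz0]⟩
  | insert a D haD hmax ih =>
    rw [Finset.coe_insert] at h
    have hunion : {σ : Finset V | ∃ j ∈ insert a D, ↑σ ⊆ C j} =
        {σ : Finset V | ∃ j ∈ D, ↑σ ⊆ C j} ∪ {σ : Finset V | ↑σ ⊆ C a} := by
      ext σ
      simp [or_comm]
    rw [hunion]
    have hacyc := ih (h.of_insert hmax) fun j hj => hC j (Finset.mem_insert_of_mem hj)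
    exact hacyc.union_powerset
      (fun σ τ hτσ ⟨j, hj, hσ⟩ => ⟨j, hj, (Finset.coe_subset.2 hτσ).trans hσ⟩)
      (hC a (Finset.mem_insert_self a D))
      fun σ hσ => h.exists_subset_iff_of_insert (by simpa using haD) hmax hσ

theorem isAcyclicAt (h : IsShelling C R ℓ D) (hfin : ∀ a, {j ∈ D | ℓ j ≤ a}.Finite)
    (hC : ∀ j ∈ D, ∀ σ : Finset V, C j ⊆ σ → i + 1 < σ.card) :
    IsAcyclicAt {σ : Finset V | ∃ j ∈ D, ↑σ ⊆ C j} i := by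
  intro z hz hz0
  choose f hfD hf using fun σ : z.support => (hz σ.2).1
  set D' := (hfin (Finset.univ.sup (ℓ ∘ f))).toFinset
  have hD' : ∀ j ∈ D', j ∈ D := fun j hj => ((Set.Finite.mem_toFinset _).1 hj).1
  have hshell : IsShelling C R ℓ D' := by
    rw [Set.Finite.coe_toFinset]
    exact h.setOf_le _
  have hzD' : z ∈ chainsOn {σ : Finset V | ∃ j ∈ D', ↑σ ⊆ C j} i := fun σ hσ =>
    ⟨⟨f ⟨σ, hσ⟩, (Set.Finite.mem_toFinset _).2
      ⟨hfD ⟨σ, hσ⟩, Finset.le_sup (f := ℓ ∘ f) (Finset.mem_univ _)⟩, hf ⟨σ, hσ⟩⟩, (hz hσ).2⟩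
  obtain ⟨y, hy, hyz⟩ :=
    hshell.isAcyclicAt_of_finset (fun j hj => hC j (hD' j hj)) z hzD' hz0
  refine ⟨y, chainsOn_mono ?_ _ hy, hyz⟩
  rintro σ ⟨j, hj, hσ⟩
  exact ⟨j, hD' j hj, hσ⟩

end IsShelling

section ReducedHomology

variable {V : Type u} (K : PreAbstractSimplicialComplex V) {i j : ℤ}

theorem mapDomain_val_mem_chainsOn (c : K.Chain i) :
    c.mapDomain Subtype.val ∈ chainsOn {σ | σ = ∅ ∨ σ ∈ K.faces} i := by
  classical
  intro σ hσ
  obtain ⟨τ, -, rfl⟩ := Finset.mem_image.1 (Finsupp.mapDomain_support hσ)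
  exact τ.2

theorem exists_mapDomain_val_eq {y : Finset V →₀ ZMod 2}
    (hy : y ∈ chainsOn {σ | σ = ∅ ∨ σ ∈ K.faces} i) :
    ∃ c : K.Chain i, c.mapDomain Subtype.val = y :=
  ⟨y.comapDomain Subtype.val Subtype.val_injective.injOn,
    Finsupp.mapDomain_comapDomain _ Subtype.val_injective _ fun σ hσ => ⟨⟨σ, hy hσ⟩, rfl⟩⟩

variable [DecidableEq V]

theorem simplexBoundary_mapDomain_val (h : j + 1 = i) (c : K.Chain i) :
    simplexBoundary (c.mapDomain Subtype.val) = (K.boundary i j h c).mapDomain Subtype.val := by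
  suffices H : simplexBoundary ∘ₗ Finsupp.lmapDomain (ZMod 2) (ZMod 2) Subtype.val =
      Finsupp.lmapDomain (ZMod 2) (ZMod 2) Subtype.val ∘ₗ K.boundary i j h from
    LinearMap.congr_fun H c
  refine Finsupp.lhom_ext' fun σ => LinearMap.ext_ring ?_
  simp only [LinearMap.comp_apply, Finsupp.lsingle_apply, Finsupp.lmapDomain_apply,
    Finsupp.mapDomain_single, simplexBoundary_single, PreAbstractSimplicialComplex.boundary,
    Finsupp.linearCombination_single, one_smul]
  rw [← Finsupp.lmapDomain_apply (ZMod 2) (ZMod 2), map_sum]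
  simp only [Finsupp.lmapDomain_apply, Finsupp.mapDomain_single,
    PreAbstractSimplicialComplex.facet]
  rw [← Finset.sum_coe_sort σ.1 fun v => Finsupp.single (σ.1.erase v) (1 : ZMod 2)]
  exact Finset.sum_congr rfl fun v _ => by congr!

theorem IsAcyclicAt.subsingleton_reducedHomology
    (h : IsAcyclicAt {σ | σ = ∅ ∨ σ ∈ K.faces} i) : Subsingleton (K.ReducedHomology i) := by
  rw [Submodule.Quotient.subsingleton_iff, eq_top_iff]
  rintro ⟨z, hz⟩ -
  obtain ⟨y, hy, hyz⟩ := h _ (mapDomain_val_mem_chainsOn K z) (by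
    rw [simplexBoundary_mapDomain_val K (sub_add_cancel i 1), LinearMap.mem_ker.1 hz,
      Finsupp.mapDomain_zero])
  obtain ⟨c, rfl⟩ := exists_mapDomain_val_eq K hy
  rw [simplexBoundary_mapDomain_val K rfl] at hyz
  exact ⟨c, Finsupp.mapDomain_injective Subtype.val_injective hyz⟩

end ReducedHomology

theorem mem_faces_iInf {V ι : Type*} [Nonempty ι] {K : ι → PreAbstractSimplicialComplex V}
    {σ : Finset V} : σ ∈ (⨅ j, K j).faces ↔ ∀ j, σ ∈ (K j).faces := by
  refine ⟨fun h j => iInf_le K j h, fun h => ⟨by simpa using h, ?_⟩⟩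
  exact ((K (Classical.arbitrary ι)).isRelLowerSet_faces (h _)).1

namespace BNPair

variable {G : Type u} [Group G] (P : BNPair G) {ι : Type*} {T : Set P.S} {s t : P.S}
  {v w : P.Weyl} {c g h x : G}

theorem vertex_eq_iff : P.vertex g s = P.vertex h s ↔ g⁻¹ * h ∈ P.parabolic {s}ᶜ := by
  rw [← QuotientGroup.eq]
  simp [vertex]

variable {P} in
theorem eq_of_vertex_eq (e : P.vertex g s = P.vertex h t) : s = t :=
  congrArg Sigma.fst e

theorem vertex_mul_of_mem_B (hc : c ∈ P.B) (s : P.S) : P.vertex (g * c) s = P.vertex g s := by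
  rw [eq_comm, vertex_eq_iff, inv_mul_cancel_left]
  exact P.B_le_parabolic _ hc

theorem chamber_mul_of_mem_B (hc : c ∈ P.B) : P.chamber (g * c) = P.chamber g :=
  congrArg Set.range (funext (P.vertex_mul_of_mem_B hc))

theorem mem_B_of_forall_vertex_eq (e : ∀ s, P.vertex g s = P.vertex h s) : g⁻¹ * h ∈ P.B := by
  have hmem := P.mem_parabolic_compl (T := Set.univ) fun s _ => P.vertex_eq_iff.1 (e s)
  obtain ⟨w, hw, hg⟩ := P.mem_parabolic_iff.1 hmem
  rw [weylParabolic, Set.compl_univ, Set.image_empty, Subgroup.closure_empty,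
    Subgroup.mem_bot] at hw
  exact (P.eq_one_iff_of_mem_cell hg).1 hw

/-- The vertex `x w G_(s)` of the apartment `A_x`, for `w` in the Weyl group. It does not depend on
the representative of `w` in `N`, which is `Quotient.out w` here. -/
noncomputable def weylVertex (x : G) (w : P.Weyl) (s : P.S) : P.Vertex :=
  P.vertex (x * (w.out : P.N)) s

theorem mk_out (w : P.Weyl) : ((w.out : P.N) : P.Weyl) = w :=
  Quotient.out_eq w

theorem out_mem_cell (w : P.Weyl) : ((w.out : P.N) : G) ∈ P.cell w := by
  simpa only [mk_out] using P.coe_mem_cell w.out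

theorem weylVertex_eq_iff :
    P.weylVertex x w s = P.weylVertex x v s ↔ w⁻¹ * v ∈ P.weylParabolic {s}ᶜ := by
  have hcell := P.coe_mem_cell (w.out⁻¹ * v.out)
  rw [QuotientGroup.mk_mul, QuotientGroup.mk_inv, mk_out, mk_out] at hcell
  rw [← P.mem_parabolic_iff_of_mem_cell hcell, weylVertex, weylVertex, vertex_eq_iff]
  simp [mul_assoc]

theorem vertex_mul_coe (n : P.N) : P.vertex (x * n) s = P.weylVertex x n s := by
  have hB : (n : G)⁻¹ * ((n : P.Weyl).out : P.N) ∈ P.B := by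
    have hone : ((n⁻¹ * (n : P.Weyl).out : P.N) : P.Weyl) = 1 := by
      rw [QuotientGroup.mk_mul, QuotientGroup.mk_inv, mk_out, inv_mul_cancel]
    simpa using P.coe_eq_one_iff.1 hone
  rw [← P.vertex_mul_of_mem_B hB, mul_assoc, mul_inv_cancel_left, weylVertex]

theorem mem_apartmentVertices_iff {p : P.Vertex} :
    p ∈ P.apartmentVertices x ↔ ∃ w s, p = P.weylVertex x w s := by
  constructor
  · rintro ⟨n, s, rfl⟩
    exact ⟨n, s, P.vertex_mul_coe n⟩
  · rintro ⟨w, s, rfl⟩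
    exact ⟨w.out, s, rfl⟩

theorem inv_mul_mem_of_weylVertex_eq (hc : c ∈ P.B)
    (e : P.weylVertex x w s = P.weylVertex (x * c) v s) : w⁻¹ * v ∈ P.weylParabolic {s}ᶜ := by
  obtain ⟨u, hu, hcell⟩ := P.exists_mul_mem_cell (P.out_mem_cell w) (P.vertex_eq_iff.1 e)
  have hcell' : c * (v.out : P.N) ∈ P.cell (w * u) := by simpa [mul_assoc] using hcell
  rw [P.cell_unique (P.left_mul_mem_cell hc (P.out_mem_cell v)) hcell', inv_mul_cancel_left]
  exact hu

theorem weylVertex_mem_apartmentVertices_mul_iff (hc : c ∈ P.B) :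
    P.weylVertex x w s ∈ P.apartmentVertices (x * c) ↔
      P.weylVertex x w s = P.weylVertex (x * c) w s := by
  rw [mem_apartmentVertices_iff]
  refine ⟨?_, fun e => ⟨w, s, e⟩⟩
  rintro ⟨v, t, e⟩
  obtain rfl := eq_of_vertex_eq e
  rw [e, eq_comm, weylVertex_eq_iff]
  exact P.inv_mul_mem_of_weylVertex_eq hc e

theorem exists_subset_range_weylVertex {σ : Set P.Vertex} (hσ : σ ⊆ P.chamber h)
    (hσx : σ ⊆ P.apartmentVertices x) : ∃ w, σ ⊆ Set.range (P.weylVertex x w) := by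
  obtain ⟨w, n, rfl, b, hb, c, hc, e⟩ := P.exists_mem_cell (x⁻¹ * h)
  have hh : P.chamber h = Set.range (P.weylVertex (x * b) n) := by
    rw [inv_mul_eq_iff_eq_mul.1 e, ← mul_assoc, P.chamber_mul_of_mem_B hc, ← mul_assoc]
    exact congrArg Set.range (funext fun s => P.vertex_mul_coe n)
  refine ⟨n, fun p hp => ?_⟩
  obtain ⟨v, s, rfl⟩ := P.mem_apartmentVertices_iff.1 (hσx hp)
  obtain ⟨t, e⟩ := hh ▸ hσ hp
  obtain rfl := eq_of_vertex_eq e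
  refine ⟨t, P.weylVertex_eq_iff.2 ?_⟩
  rw [← inv_mem_iff, mul_inv_rev, inv_inv]
  exact P.inv_mul_mem_of_weylVertex_eq hb e.symm

/-- If two apartments sharing the chamber of `x` share the face of type `T` of the chamber `x w`,
then they share its gate, the chamber of that face nearest to the chamber of `x`. -/
theorem weylVertex_eq_of_isMinCosetRep (hc : c ∈ P.B)
    (hw : IsMinCosetRep P.S (Subtype.val '' Tᶜ) w)
    (hT : ∀ s ∈ T, P.weylVertex x w s = P.weylVertex (x * c) w s) (s : P.S) :
    P.weylVertex x w s = P.weylVertex (x * c) w s := by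
  have hT' := P.mem_parabolic_compl fun s hs => P.vertex_eq_iff.1 (hT s hs)
  obtain ⟨u, hu, hcell⟩ := P.mem_parabolic_iff.1 hT'
  have hmul : c * (w.out : P.N) ∈ P.cell (w * u) := by
    simpa [mul_assoc] using P.mul_mem_cell_of_isMinCosetRep hw hu (P.out_mem_cell w) hcell
  have hu1 := P.cell_unique hmul (P.left_mul_mem_cell hc (P.out_mem_cell w))
  rw [mul_eq_left] at hu1
  exact P.vertex_eq_iff.2 (P.B_le_parabolic _ ((P.eq_one_iff_of_mem_cell hcell).1 hu1))

theorem weylVertex_one_eq (hc : c ∈ P.B) (s : P.S) :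
    P.weylVertex x 1 s = P.weylVertex (x * c) 1 s := by
  rw [← QuotientGroup.mk_one, ← vertex_mul_coe, ← vertex_mul_coe]
  simp [P.vertex_mul_of_mem_B hc]

theorem weylVertex_mul_of_ne (hts : t ≠ s) : P.weylVertex x (w * s) t = P.weylVertex x w t := by
  rw [eq_comm, weylVertex_eq_iff, inv_mul_cancel_left]
  exact Subgroup.subset_closure ⟨s, hts.symm, rfl⟩

theorem apartmentVertices_mul_coe (g : G) (n : P.N) :
    P.apartmentVertices (g * n) = P.apartmentVertices g := by
  ext v
  constructor
  · rintro ⟨m, s, rfl⟩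
    exact ⟨n * m, s, by simp [mul_assoc]⟩
  · rintro ⟨m, s, rfl⟩
    exact ⟨n⁻¹ * m, s, by simp [mul_assoc]⟩

theorem exists_apartment_eq_mul (hg : P.chamber h ⊆ P.apartmentVertices g) :
    ∃ b ∈ P.B, P.apartment g = P.apartment (h * b) := by
  obtain ⟨w, hw⟩ := P.exists_subset_range_weylVertex subset_rfl hg
  refine ⟨h⁻¹ * (g * (w.out : P.N)), P.mem_B_of_forall_vertex_eq fun s => ?_, ?_⟩
  · obtain ⟨t, e⟩ := hw ⟨s, rfl⟩
    obtain rfl := eq_of_vertex_eq e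
    exact e.symm
  · rw [mul_inv_cancel_left, apartment, apartment, apartmentVertices_mul_coe]

theorem ncard_chamber (g : G) : (P.chamber g).ncard = P.rank := by
  rw [chamber, ← Set.image_univ, Set.ncard_image_of_injective _ fun s t => eq_of_vertex_eq,
    Set.ncard_univ, rank]

/-- The Weyl elements `w` whose chamber `x w` is, vertex by vertex, the chamber `x c_j w` of each
of the apartments of the `x c_j`. -/
def sharedChambers (x : G) (c : ι → G) : Set P.Weyl :=
  {w | ∀ j s, P.weylVertex x w s = P.weylVertex (x * c j) w s}

section sharedChambers

variable {c : ι → G} (hc : ∀ j, c j ∈ P.B)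
include hc

theorem one_mem_sharedChambers : 1 ∈ P.sharedChambers x c := fun j =>
  P.weylVertex_one_eq (hc j)

theorem mul_mem_sharedChambers (hw : w ∈ P.sharedChambers x c)
    (hlt : wordLength P.S (w * s) < wordLength P.S w) : w * s ∈ P.sharedChambers x c := by
  have hmin : IsMinCosetRep P.S (Subtype.val '' ({s}ᶜ : Set P.S)ᶜ) (w * s) := by
    rw [compl_compl, Set.image_singleton]
    refine P.isCoxeterGenerating.isMinCosetRep_of_forall_lt (Set.singleton_subset_iff.2 s.2) ?_
    rintro _ rfl
    rwa [mul_assoc, P.S_mul_self s.2, mul_one]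
  refine fun j => P.weylVertex_eq_of_isMinCosetRep (hc j) hmin fun t hts => ?_
  rw [P.weylVertex_mul_of_ne hts, P.weylVertex_mul_of_ne hts, hw j t]

theorem exists_mem_sharedChambers_weylVertex_eq
    (hT : ∀ j, ∀ s ∈ T, P.weylVertex x w s ∈ P.apartmentVertices (x * c j)) :
    ∃ v ∈ P.sharedChambers x c, ∀ s ∈ T, P.weylVertex x v s = P.weylVertex x w s := by
  obtain ⟨u, hu, hmin⟩ := exists_isMinCosetRep P.S (Subtype.val '' Tᶜ) w
  have hface : ∀ s ∈ T, P.weylVertex x (w * u) s = P.weylVertex x w s := fun s hs => by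
    rw [eq_comm, weylVertex_eq_iff, inv_mul_cancel_left]
    exact Subgroup.closure_mono (Set.image_mono (by simpa using hs)) hu
  refine ⟨w * u, fun j => P.weylVertex_eq_of_isMinCosetRep (hc j) hmin fun s hs => ?_, hface⟩
  rw [← weylVertex_mem_apartmentVertices_mul_iff P (hc j), hface s hs]
  exact hT j s hs

theorem mem_faces_iInf_apartment_iff {j₀ : ι} (hj₀ : c j₀ = 1) {σ : Finset P.Vertex} :
    σ ∈ (⨅ j, P.apartment (x * c j)).faces ↔
      σ.Nonempty ∧ ∃ w ∈ P.sharedChambers x c, ↑σ ⊆ Set.range (P.weylVertex x w) := by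
  have : Nonempty ι := ⟨j₀⟩
  rw [mem_faces_iInf]
  constructor
  · intro hσ
    obtain ⟨⟨hne, h, hσh⟩, hσx⟩ := hσ j₀
    rw [hj₀, mul_one] at hσx
    obtain ⟨w, hw⟩ := P.exists_subset_range_weylVertex hσh hσx
    obtain ⟨v, hv, hvw⟩ := P.exists_mem_sharedChambers_weylVertex_eq hc
      (T := {s | P.weylVertex x w s ∈ σ}) fun j s hs => (hσ j).2 hs
    refine ⟨hne, v, hv, fun p hp => ?_⟩
    obtain ⟨s, rfl⟩ := hw hp
    exact ⟨s, hvw s hp⟩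
  · rintro ⟨hne, w, hw, hσ⟩ j
    refine ⟨⟨hne, _, hσ⟩, fun p hp => ?_⟩
    obtain ⟨s, rfl⟩ := hσ hp
    exact (P.weylVertex_mem_apartmentVertices_mul_iff (hc j)).2 (hw j s)

theorem setOf_eq_empty_or_mem_faces_iInf_apartment {j₀ : ι} (hj₀ : c j₀ = 1) :
    {σ | σ = ∅ ∨ σ ∈ (⨅ j, P.apartment (x * c j)).faces} =
      {σ : Finset P.Vertex | ∃ w ∈ P.sharedChambers x c, ↑σ ⊆ Set.range (P.weylVertex x w)} := by
  ext σ
  rw [Set.mem_ofPred_eq, P.mem_faces_iInf_apartment_iff hc hj₀]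
  rcases σ.eq_empty_or_nonempty with rfl | hne
  · simpa using ⟨1, P.one_mem_sharedChambers hc⟩
  · simp only [hne.ne_empty, hne, false_or, true_and, Set.mem_ofPred_eq]

theorem isShelling_sharedChambers :
    IsShelling (fun w => Set.range (P.weylVertex x w))
      (fun w => P.weylVertex x w '' {s | wordLength P.S (w * s) < wordLength P.S w})
      (wordLength P.S) (P.sharedChambers x c) where
  diff_singleton_subset w hw := by
    rintro _ ⟨s, hlt, rfl⟩
    refine ⟨w * s, P.mul_mem_sharedChambers hc hw hlt, hlt, ?_⟩
    rintro _ ⟨⟨t, rfl⟩, hts⟩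
    exact ⟨t, P.weylVertex_mul_of_ne (by rintro rfl; exact hts rfl)⟩
  not_subset w _ v _ hne hle hsub := by
    set D : Set P.S := {s | wordLength P.S (w * s) < wordLength P.S w}
    have hmin : IsMinCosetRep P.S (Subtype.val '' Dᶜ) w := by
      refine P.isCoxeterGenerating.isMinCosetRep_of_forall_lt (Subtype.coe_image_subset _ _) ?_
      rintro _ ⟨s, hs, rfl⟩
      exact lt_of_le_of_ne (not_lt.1 hs) (P.isCoxeterGenerating.wordLength_mul_ne s s.2 w).symm
    have hmem : w⁻¹ * v ∈ P.weylParabolic Dᶜ := P.mem_weylParabolic_compl fun s hs => by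
      obtain ⟨t, e⟩ := hsub ⟨s, hs, rfl⟩
      obtain rfl := eq_of_vertex_eq e
      exact P.weylVertex_eq_iff.1 e.symm
    have hlt := P.isCoxeterGenerating.wordLength_lt_of_isMinCosetRep
      (Subtype.coe_image_subset _ _) hmin hmem fun e => hne (inv_mul_eq_one.1 e).symm
    rw [mul_inv_cancel_left] at hlt
    exact hlt.not_ge hle

theorem isAcyclicAt_sharedChambers [DecidableEq P.Vertex] [Finite P.S] {i : ℤ}
    (hi : i + 1 < P.rank) :
    IsAcyclicAt {σ : Finset P.Vertex |
      ∃ w ∈ P.sharedChambers x c, ↑σ ⊆ Set.range (P.weylVertex x w)} i := by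
  have hfin : ∀ a, {w ∈ P.sharedChambers x c | wordLength P.S w ≤ a}.Finite := fun a =>
    (finite_setOf_wordLength_le P.submonoid_closure_S P.S.toFinite a).subset fun _ hw => hw.2
  refine (P.isShelling_sharedChambers hc).isAcyclicAt hfin fun w _ σ hσ => ?_
  have hcard : P.rank ≤ σ.card := by
    rw [← P.ncard_chamber (x * (w.out : P.N)), ← Set.ncard_coe_finset]
    exact Set.ncard_le_ncard hσ
  lia

end sharedChambers

theorem exists_apartment_eq_mul_of_card_eq_rank [Finite P.S] [Nonempty ι] {g : ι → G}
    {σ : Finset P.Vertex} (hσ : σ ∈ (⨅ j, P.apartment (g j)).faces) (hcard : σ.card = P.rank) :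
    ∃ (x : G) (c : ι → G) (j₀ : ι), (∀ j, c j ∈ P.B) ∧ c j₀ = 1 ∧
      ∀ j, P.apartment (g j) = P.apartment (x * c j) := by
  rw [mem_faces_iInf] at hσ
  let j₀ := Classical.arbitrary ι
  obtain ⟨⟨-, h, hσh⟩, -⟩ := hσ j₀
  have hchamber : P.chamber h = σ := by
    refine (Set.eq_of_subset_of_ncard_le hσh ?_ (Set.finite_range _)).symm
    rw [ncard_chamber, Set.ncard_coe_finset, hcard]
  choose b hb hgb using fun j => P.exists_apartment_eq_mul (hchamber ▸ (hσ j).2)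
  refine ⟨h * b j₀, fun j => (b j₀)⁻¹ * b j, j₀, fun j => P.B.mul_mem (inv_mem (hb j₀)) (hb j),
    inv_mul_cancel _, fun j => ?_⟩
  rw [hgb j, mul_assoc, mul_inv_cancel_left]

end BNPair

theorem claim3p3_general {G : Type*} [Group G] (P : BNPair G) (n : ℕ) (hrank : P.rank = n + 1)
    {ι : Type*} [Nonempty ι] (g : ι → G) (hdim : (⨅ j, P.apartment (g j)).HasDim (n : ℤ))
    (i : ℤ) (hi : i ≤ (n : ℤ) - 1) :
    Subsingleton ((⨅ j, P.apartment (g j)).ReducedHomology i) := by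
  classical
  have hfin : Finite P.S := Nat.finite_of_card_ne_zero (hrank.trans_ne n.succ_ne_zero)
  obtain ⟨σ, hσ, hcard : (σ.card : ℤ) - 1 = n⟩ := hdim.1
  obtain ⟨x, c, j₀, hc, hj₀, hg⟩ := P.exists_apartment_eq_mul_of_card_eq_rank hσ (by lia)
  simp only [hg]
  apply IsAcyclicAt.subsingleton_reducedHomology
  rw [P.setOf_eq_empty_or_mem_faces_iInf_apartment hc hj₀]
  exact P.isAcyclicAt_sharedChambers hc (by lia)

theorem claim3p3 {G : Type*} [Group G] [Finite G] (P : BNPair G) (n : ℕ) (hrank : P.rank = n + 1)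
    (k : ℕ) (hk : 1 ≤ k) (g : Fin k → G) (hdim : (⨅ j, P.apartment (g j)).HasDim (n : ℤ))
    (i : ℤ) (hi : i ≤ (n : ℤ) - 1) :
    Subsingleton ((⨅ j, P.apartment (g j)).ReducedHomology i) := by
  have : Nonempty (Fin k) := ⟨⟨0, hk⟩⟩
  exact claim3p3_general P n hrank g hdim i hi
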